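/- Let $E,A\in\mathbb F^{n\times n}$, $B\in\mathbb F^{n\times m}$, $C\in\mathbb F^{m\times n}$, $D\in\mathbb F^{m\times m}$ with $\mathbb F=\mathbb R$ or $\mathbb F=\mathbb C$, and suppose that $\det(sE-A)$ is not identically zero. Consider the descriptor system $$E\dot x=Ax+B(u+w),\qquad y=Cx+D(u+w),$$ with transfer function $G(s)=C(sE-A)^{-1}B+D$. Definitions. An eigenvalue of a matrix pair $(E,A')$ is a number $\lambda\in\mathbb C$ with $(\lambda E-A')v=0$ for some non-zero $v\in\mathbb C^n$; the pair is stable if all its eigenvalues have negative real part. A number $\lambda\in\mathbb C$ is a (finite) pole of a rational matrix function $H$ if $\lim_{s\to\lambda}H(s)$ does not exist; infinity is a pole of $H$ if $\lim_{s\to\infty}H(s)$ does not exist, and then its order is the smallest integer $l$ for which $\lim_{s\to\infty}s^{-l}H(s)$ exists. A square rational $H$ is strictly positive real (SPR) if there is $\epsilon>0$ such that $H(s)+H(s)^*$ is positive definite for every $s\in\mathbb C$ with $\operatorname{Re}s\ge-\epsilon$ that is not a pole of $H$. A number $\lambda\in\mathbb C$ is an uncontrollable eigenvalue of the system if $\begin{bmatrix}\lambda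 E-A & B\end{bmatrix}$ does not have maximum rank, and an unobservable eigenvalue if $\begin{bmatrix}\lambda E-A\\ C\end{bmatrix}$ does not have maximum rank. Theorem. There exist matrices $K,L\in\mathbb F^{m\times m}$, with $I-KD$ non-singular, such that the pair $(E,\;A+B(I-KD)^{-1}KC)$ is stable and the transfer function $L(I-GK)^{-1}G$ is SPR, if and only if $G$ is invertible as a rational matrix and the following conditions hold: (a) every finite pole of $G^{-1}$ has negative real part; (b) if $G^{-1}$ has a pole at infinity, then its order is one; (c) every uncontrollable and every unobservable eigenvalue of the system has negative real part. -/

import Mathlib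

open scoped Matrix ComplexOrder Topology

noncomputable section

namespace SPRification

/-- A rational transfer matrix: an `m × m` matrix over the field `ℂ(s)`. -/
abbrev TransferMatrix (m : ℕ) : Type := Matrix (Fin m) (Fin m) (RatFunc ℂ)

/-- A matrix over `𝕜` (`ℝ` or `ℂ`) regarded as a complex matrix. -/
def toC {𝕜 : Type*} [RCLike 𝕜] {p q : Type*} (M : Matrix p q 𝕜) : Matrix p q ℂ :=
  M.map (RCLike.map 𝕜 ℂ)

/-- A complex matrix regarded as a constant rational matrix. -/
def constMat {p q : Type*} (M : Matrix p q ℂ) : Matrix p q (RatFunc ℂ) :=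
  M.map RatFunc.C

/-- The value `H(s)` of a rational matrix. The entries are evaluated as reduced fractions, so this
is the genuine value wherever `s` is not a pole. -/
def valueAt {m : ℕ} (H : TransferMatrix m) (s : ℂ) : Matrix (Fin m) (Fin m) ℂ :=
  H.map (RatFunc.eval (RingHom.id ℂ) s)

/-- The finite number `z` is a pole of `H` if `lim_{s → z} H(s)` does not exist. -/
def IsPole {m : ℕ} (H : TransferMatrix m) (z : ℂ) : Prop :=
  ¬ ∃ M : Matrix (Fin m) (Fin m) ℂ, Filter.Tendsto (valueAt H) (𝓝[≠] z) (𝓝 M)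

/-- `lim_{s → ∞} s^{-l} H(s)` exists (as `|s| → ∞` in the complex plane). -/
def HasScaledLimitAtInfinity {m : ℕ} (H : TransferMatrix m) (l : ℤ) : Prop :=
  ∃ M : Matrix (Fin m) (Fin m) ℂ,
    Filter.Tendsto (fun s : ℂ => s ^ (-l) • valueAt H s) (Bornology.cobounded ℂ) (𝓝 M)

/-- Infinity is a pole of `H` if `lim_{s → ∞} H(s)` does not exist. -/
def IsPoleAtInfinity {m : ℕ} (H : TransferMatrix m) : Prop :=
  ¬ ∃ M : Matrix (Fin m) (Fin m) ℂ,
    Filter.Tendsto (valueAt H) (Bornology.cobounded ℂ) (𝓝 M)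

/-- Infinity, when it is a pole of `H`, has order `l`: `l` is the smallest integer for which
`lim_{s → ∞} s^{-l} H(s)` exists. -/
def HasOrderAtInfinity {m : ℕ} (H : TransferMatrix m) (l : ℤ) : Prop :=
  IsLeast {k : ℤ | HasScaledLimitAtInfinity H k} l

/-- Strict positive realness: there is `ε > 0` with `H(s) + H(s)ᴴ > 0` for every `s` with
`Re s ≥ -ε` that is not a pole of `H`. -/
def IsSPR {m : ℕ} (H : TransferMatrix m) : Prop :=
  ∃ ε : ℝ, 0 < ε ∧ ∀ s : ℂ, -ε ≤ s.re → ¬ IsPole H s →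
    (valueAt H s + (valueAt H s)ᴴ).PosDef

/-- `z` is an eigenvalue of the matrix pair `(E, A)`. -/
def IsPairEigenvalue {n : ℕ} (E A : Matrix (Fin n) (Fin n) ℂ) (z : ℂ) : Prop :=
  ∃ v : Fin n → ℂ, v ≠ 0 ∧ (z • E - A) *ᵥ v = 0

/-- The pair `(E, A)` is stable: all its eigenvalues have negative real part. -/
def IsStablePair {n : ℕ} (E A : Matrix (Fin n) (Fin n) ℂ) : Prop :=
  ∀ z : ℂ, IsPairEigenvalue E A z → z.re < 0

/-- The data of the descriptor system `E ẋ = A x + B (u + w)`, `y = C x + D (u + w)` with `n` states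
and `m` inputs and outputs. -/
structure DescriptorSystem (𝕜 : Type*) (n m : ℕ) where
  E : Matrix (Fin n) (Fin n) 𝕜
  A : Matrix (Fin n) (Fin n) 𝕜
  B : Matrix (Fin n) (Fin m) 𝕜
  C : Matrix (Fin m) (Fin n) 𝕜
  D : Matrix (Fin m) (Fin m) 𝕜

namespace DescriptorSystem

variable {𝕜 : Type*} [RCLike 𝕜] {n m : ℕ}

/-- `det (s E - A)` is not identically zero. -/
def IsRegular (S : DescriptorSystem 𝕜 n m) : Prop :=
  ∃ s : ℂ, (s • toC S.E - toC S.A).det ≠ 0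

/-- The transfer function `G(s) = C (s E - A)⁻¹ B + D`. -/
def transfer (S : DescriptorSystem 𝕜 n m) : TransferMatrix m :=
  constMat (toC S.C) * ((RatFunc.X : RatFunc ℂ) • constMat (toC S.E) - constMat (toC S.A))⁻¹ * constMat (toC S.B) +
    constMat (toC S.D)

/-- The closed-loop state matrix `A + B (I - K D)⁻¹ K C` under the output feedback `u = K y`. -/
def closedLoopA (S : DescriptorSystem 𝕜 n m) (K : Matrix (Fin m) (Fin m) 𝕜) :
    Matrix (Fin n) (Fin n) 𝕜 :=
  S.A + S.B * (1 - K * S.D)⁻¹ * K * S.C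

/-- The closed-loop transfer function `L (I - G K)⁻¹ G` from `w` to `z = L y`. -/
def closedLoopTransfer (S : DescriptorSystem 𝕜 n m) (K L : Matrix (Fin m) (Fin m) 𝕜) :
    TransferMatrix m :=
  constMat (toC L) * (1 - S.transfer * constMat (toC K))⁻¹ * S.transfer

/-- `z` is an uncontrollable eigenvalue: `[z E - A, B]` does not have maximum rank. -/
def IsUncontrollableEigenvalue (S : DescriptorSystem 𝕜 n m) (z : ℂ) : Prop :=
  (Matrix.fromCols (z • toC S.E - toC S.A) (toC S.B)).rank < n

/-- `z` is an unobservable eigenvalue: `[z E - A; C]` does not have maximum rank. -/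
def IsUnobservableEigenvalue (S : DescriptorSystem 𝕜 n m) (z : ℂ) : Prop :=
  (Matrix.fromRows (z • toC S.E - toC S.A) (toC S.C)).rank < n

/-- There are gains `K`, `L` over the scalar field of the system, with `I - K D` non-singular, for
which the closed-loop system is stable and the closed-loop transfer function is SPR. -/
def CanBeMadeStableSPR (S : DescriptorSystem 𝕜 n m) : Prop :=
  ∃ K L : Matrix (Fin m) (Fin m) 𝕜, IsUnit (1 - K * S.D) ∧
    IsStablePair (toC S.E) (toC (S.closedLoopA K)) ∧
    IsSPR (S.closedLoopTransfer K L)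

end DescriptorSystem

end SPRification

end

/-!
Write `G` for the transfer function. If `L` is invertible, the closed-loop transfer function
`H = L (I - G K)⁻¹ G` satisfies `H⁻¹ = (G⁻¹ - K) L⁻¹`, and `H` has positive definite Hermitian part
at a point exactly when `H⁻¹` has. The theorem is a statement about this affine function of `G⁻¹`.

Necessity (`IsSPR.inverse`). Near any point with `Re z ≥ 0` the quadratic forms of `H⁻¹` have
nonnegative real part. A scalar rational function `f` with this property has no pole there, because
`1 / f` is an open map (`mem_regularAt_of_re_nonneg`), and it grows at most linearly at infinity,
because `c s ^ d` with `d ≥ 2` takes negative values in the right half plane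
(`intDegree_le_one_of_re_nonneg`). Polarization passes to the entries of `H⁻¹`, hence of
`G⁻¹ = H⁻¹ L + K`. Uncontrollable and unobservable eigenvalues survive the feedback.

Sufficiency (`DescriptorSystem.canBeMadeStableSPR`). Let `M` be the limit of `G⁻¹(s) / s` at
infinity; it has entries in the scalar field of the system. Choose an invertible `T` with
`M T = N Nᴴ`, and put `L = T⁻¹` and `K = -k T⁻¹`, so that `H⁻¹ = G⁻¹ T + k`. On a half plane
`Re s ≥ -ε` the function `G⁻¹ T - s M T` is bounded, so for large `k` the Hermitian part of `H⁻¹` is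
positive definite (`exists_forall_gt_posDef`). For stability, a closed-loop eigenvector at `z` with
`Re z ≥ 0` yields an input `u` and an output `y` with `G⁻¹(z) y = u = K y`, although `G` may have a
pole at `z`; this uses controllability at `z` (`DescriptorSystem.exists_mul_pencil_eq`). Since
`G⁻¹(z) - K` is invertible, `u` and `y` vanish, and the eigenvector is unobservable.
-/

noncomputable section

namespace SPRification

open Filter Polynomial

/-! ### Scalar rational functions -/

/-- The local ring of rational functions that are regular at `z`: those whose reduced denominator
does not vanish at `z`. -/
def regularAt (z : ℂ) : Subring (RatFunc ℂ) where
  carrier := {f | f.denom.eval z ≠ 0}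
  mul_mem' {f g} hf hg h := by
    have := eval_dvd (RatFunc.denom_mul_dvd f g) (x := z)
    rw [h, zero_dvd_iff, eval_mul] at this
    exact mul_ne_zero hf hg this
  one_mem' := by simp
  add_mem' {f g} hf hg h := by
    have := eval_dvd (RatFunc.denom_add_dvd f g) (x := z)
    rw [h, zero_dvd_iff, eval_mul] at this
    exact mul_ne_zero hf hg this
  zero_mem' := by simp
  neg_mem' {f} hf h := by
    have h1 : (-f).denom ∣ (-1 : RatFunc ℂ).denom * f.denom := by
      rw [← neg_one_mul]; exact RatFunc.denom_mul_dvd _ _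
    have h2 : (-1 : RatFunc ℂ).denom = 1 := by
      have := RatFunc.denom_C (-1 : ℂ)
      rwa [map_neg, map_one] at this
    rw [h2, one_mul] at h1
    have := eval_dvd h1 (x := z)
    rw [h, zero_dvd_iff] at this
    exact hf this

theorem mem_regularAt {z : ℂ} {f : RatFunc ℂ} : f ∈ regularAt z ↔ f.denom.eval z ≠ 0 := Iff.rfl

/-- The value at `z` of the reduced fraction of a rational function; it is `0` at a pole. -/
abbrev val (z : ℂ) (f : RatFunc ℂ) : ℂ := RatFunc.eval (RingHom.id ℂ) z f

theorem val_eq (z : ℂ) (f : RatFunc ℂ) : val z f = f.num.eval z / f.denom.eval z := by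
  simp [val, RatFunc.eval, eval₂_id]

/-- Evaluation at `z` as a ring homomorphism on the local ring at `z`. -/
def evalHom (z : ℂ) : regularAt z →+* ℂ where
  toFun f := val z f
  map_one' := by simp [val]
  map_zero' := by simp [val]
  map_mul' f g := RatFunc.eval_mul _ _ (by rw [eval₂_id]; exact f.2) (by rw [eval₂_id]; exact g.2)
  map_add' f g := RatFunc.eval_add _ _ (by rw [eval₂_id]; exact f.2) (by rw [eval₂_id]; exact g.2)

theorem evalHom_apply (z : ℂ) (f : regularAt z) : evalHom z f = val z f := rfl

theorem C_mem_regularAt (z c : ℂ) : RatFunc.C c ∈ regularAt z := by simp [mem_regularAt]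

theorem X_mem_regularAt (z : ℂ) : (RatFunc.X : RatFunc ℂ) ∈ regularAt z := by simp [mem_regularAt]

theorem val_add {z : ℂ} {f g : RatFunc ℂ} (hf : f ∈ regularAt z) (hg : g ∈ regularAt z) :
    val z (f + g) = val z f + val z g := map_add (evalHom z) ⟨f, hf⟩ ⟨g, hg⟩

theorem val_sub {z : ℂ} {f g : RatFunc ℂ} (hf : f ∈ regularAt z) (hg : g ∈ regularAt z) :
    val z (f - g) = val z f - val z g := map_sub (evalHom z) ⟨f, hf⟩ ⟨g, hg⟩

theorem val_mul {z : ℂ} {f g : RatFunc ℂ} (hf : f ∈ regularAt z) (hg : g ∈ regularAt z) :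
    val z (f * g) = val z f * val z g := map_mul (evalHom z) ⟨f, hf⟩ ⟨g, hg⟩

theorem inv_mem_regularAt {z : ℂ} {f : RatFunc ℂ} (hv : val z f ≠ 0) : f⁻¹ ∈ regularAt z := by
  have h0 : f ≠ 0 := by rintro rfl; simp [val] at hv
  rw [val_eq] at hv
  intro h
  have := eval_dvd (RatFunc.denom_inv_dvd h0) (x := z)
  rw [h, zero_dvd_iff] at this
  simp [this] at hv

theorem eventually_mem_regularAt (f : RatFunc ℂ) : ∀ᶠ s in cofinite, f ∈ regularAt s := by
  have := (finite_setOfPred_isRoot f.denom_ne_zero)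
  filter_upwards [this.compl_mem_cofinite] with s hs
  exact hs

theorem eventually_val_ne_zero {f : RatFunc ℂ} (hf : f ≠ 0) : ∀ᶠ s in cofinite, val s f ≠ 0 := by
  have := (finite_setOfPred_isRoot (RatFunc.num_ne_zero hf))
  filter_upwards [this.compl_mem_cofinite, eventually_mem_regularAt f] with s hs h2
  rw [val_eq]
  exact div_ne_zero hs h2

theorem analyticAt_val {z : ℂ} {f : RatFunc ℂ} (hf : f ∈ regularAt z) :
    AnalyticAt ℂ (fun s => val s f) z := by
  simp only [val_eq]
  have h (p : ℂ[X]) : AnalyticAt ℂ (fun s => p.eval s) z :=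
    AnalyticAt.aeval_polynomial analyticAt_id p
  exact (h _).div (h _) hf

/-- A rational function with a limit at `z` is regular there: if the reduced denominator vanished,
then so would the numerator. -/
theorem mem_regularAt_of_tendsto {z c : ℂ} {f : RatFunc ℂ}
    (h : Tendsto (fun s => val s f) (𝓝[≠] z) (𝓝 c)) : f ∈ regularAt z := by
  intro h0
  have hc (p : ℂ[X]) : Tendsto (fun s => p.eval s) (𝓝[≠] z) (𝓝 (p.eval z)) :=
    p.continuous.continuousAt.mono_left nhdsWithin_le_nhds
  have h1 : Tendsto (fun s => val s f * f.denom.eval s) (𝓝[≠] z) (𝓝 (c * f.denom.eval z)) :=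
    h.mul (hc _)
  have h2 : (fun s => val s f * f.denom.eval s) =ᶠ[𝓝[≠] z] fun s => f.num.eval s := by
    filter_upwards [nhdsNE_le_cofinite z (eventually_mem_regularAt f)] with s hs
    rw [val_eq, div_mul_cancel₀ _ hs]
  have h3 := tendsto_nhds_unique (h1.congr' h2) (hc _)
  rw [h0, mul_zero] at h3
  obtain ⟨a, b, hab⟩ := f.isCoprime_num_denom
  have := congrArg (Polynomial.eval z) hab
  simp [h0, ← h3] at this

/-- A pole of `f` is a zero of the nonconstant analytic function `1 / f`, which is open there and
so takes small negative real values. -/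
theorem mem_regularAt_of_re_nonneg {z : ℂ} {f : RatFunc ℂ}
    (h : ∀ᶠ s in 𝓝[≠] z, 0 ≤ (val s f).re) : f ∈ regularAt z := by
  by_contra hf
  have h0 : f ≠ 0 := by rintro rfl; exact hf (zero_mem _)
  have hd : f.denom.eval z = 0 := by simpa [mem_regularAt] using hf
  have hn : f.num.eval z ≠ 0 := by
    intro hn
    obtain ⟨a, b, hab⟩ := f.isCoprime_num_denom
    have := congrArg (Polynomial.eval z) hab
    simp [hd, hn] at this
  have hp (p : ℂ[X]) : AnalyticAt ℂ (fun s => p.eval s) z :=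
    AnalyticAt.aeval_polynomial analyticAt_id p
  set g : ℂ → ℂ := fun s => f.denom.eval s / f.num.eval s with hg
  have hga : AnalyticAt ℂ g z := (hp _).div (hp _) hn
  have hgz : g z = 0 := by simp [hg, hd]
  have hne : ∀ᶠ s in 𝓝[≠] z, val s f ≠ 0 := nhdsNE_le_cofinite z (eventually_val_ne_zero h0)
  have hgv : ∀ s, g s = (val s f)⁻¹ := fun s => by rw [val_eq, inv_div]
  rcases hga.eventually_constant_or_nhds_le_map_nhds with hc | ho
  · have hc' : ∀ᶠ s in 𝓝[≠] z, g s = g z := hc.filter_mono nhdsWithin_le_nhds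
    obtain ⟨s, hs1, hs2⟩ := (hne.and hc').exists
    rw [hgz, hgv, inv_eq_zero] at hs2
    exact hs1 hs2
  · rw [eventually_nhdsWithin_iff] at h
    have h1 : {w | ∃ s, (s ∈ ({z}ᶜ : Set ℂ) → 0 ≤ (val s f).re) ∧ g s = w} ∈ 𝓝 (g z) := by
      apply ho
      rw [mem_map]
      filter_upwards [h] with s hs
      exact ⟨s, hs, rfl⟩
    rw [hgz] at h1
    have h2 : Tendsto (fun t : ℝ => (-(t : ℂ))) (𝓝[>] 0) (𝓝 0) := by
      have : Continuous (fun t : ℝ => (-(t : ℂ))) := by fun_prop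
      simpa using (this.tendsto 0).mono_left nhdsWithin_le_nhds
    -- `s` is a point with `1 / f(s) = -t < 0`; it differs from `z`, where `1 / f` vanishes.
    obtain ⟨t, ⟨s, hs, hgs⟩, ht⟩ := ((h2.eventually h1).and self_mem_nhdsWithin).exists
    have ht : 0 < t := ht
    have hsz : s ≠ z := by
      rintro rfl
      rw [hgz] at hgs
      have := congrArg Complex.re hgs
      simp at this
      exact ht.ne' this
    have := hs hsz
    have h3 : val s f = ((-t⁻¹ : ℝ) : ℂ) := by
      rw [← inv_inv (val s f), ← hgv, hgs]; push_cast; rw [inv_neg]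
    rw [h3, Complex.ofReal_re] at this
    have := inv_pos.2 ht
    linarith

/-- A nonzero rational function grows at infinity like the power of `s` given by its degree. -/
theorem exists_tendsto_zpow_mul_val {f : RatFunc ℂ} (hf : f ≠ 0) :
    ∃ c : ℂ, c ≠ 0 ∧
      Tendsto (fun s => s ^ (-f.intDegree) * val s f) (Bornology.cobounded ℂ) (𝓝 c) := by
  have key (p : ℂ[X]) : Tendsto (fun s => p.eval s / s ^ p.natDegree) (Bornology.cobounded ℂ)
      (𝓝 p.leadingCoeff) := by
    have h1 : Tendsto (fun s : ℂ => p.reverse.eval s⁻¹) (Bornology.cobounded ℂ)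
        (𝓝 (p.reverse.eval 0)) :=
      (p.reverse.continuous.tendsto 0).comp tendsto_inv₀_cobounded
    have h2 : p.reverse.eval 0 = p.leadingCoeff := by
      rw [← coeff_zero_eq_eval_zero, coeff_zero_reverse]
    rw [h2] at h1
    refine h1.congr' ?_
    filter_upwards [Bornology.eventually_ne_cobounded (0 : ℂ)] with s hs
    let _ := invertibleOfNonzero hs
    have := eval₂_reverse_mul_pow (RingHom.id ℂ) s p
    rw [eval₂_id, eval₂_id, invOf_eq_inv] at this
    rw [← this, mul_div_cancel_right₀ _ (pow_ne_zero _ hs)]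
  refine ⟨f.num.leadingCoeff / f.denom.leadingCoeff, ?_, ?_⟩
  · exact div_ne_zero (by simpa using hf) (by simpa using f.denom_ne_zero)
  · refine ((key f.num).div (key f.denom) (by simpa using f.denom_ne_zero)).congr' ?_
    filter_upwards [Bornology.eventually_ne_cobounded (0 : ℂ)] with s hs
    rw [Pi.div_apply, val_eq, RatFunc.intDegree, neg_sub, zpow_sub₀ hs, zpow_natCast,
      zpow_natCast, div_div_div_comm]
    have := pow_ne_zero f.num.natDegree hs
    have := pow_ne_zero f.denom.natDegree hs
    field_simp

/-- The closed right half plane contains a direction in which `c * s ^ d` is negative as soon as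
`d ≥ 2`, so that a function with nonnegative real part there has degree at most one. -/
theorem intDegree_le_one_of_re_nonneg {f : RatFunc ℂ}
    (h : ∀ᶠ s in Bornology.cobounded ℂ, 0 ≤ s.re → 0 ≤ (val s f).re) : f.intDegree ≤ 1 := by
  by_contra! hd
  have hf : f ≠ 0 := by rintro rfl; simp at hd
  obtain ⟨c, hc, hlim⟩ := exists_tendsto_zpow_mul_val hf
  set d : ℤ := f.intDegree with hdd
  have hd2 : (2 : ℝ) ≤ d := by exact_mod_cast hd
  have hd0 : (0 : ℝ) < d := by linarith
  -- `arg c + d θ` is made equal to `π` or `-π`, whichever is nearer; then `|θ| ≤ π / d ≤ π / 2`.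
  obtain ⟨θ, hθ1, hθ2, hθ⟩ : ∃ θ : ℝ, -(Real.pi / 2) ≤ θ ∧ θ ≤ Real.pi / 2 ∧
      c * Complex.exp (d * (θ * Complex.I)) = -‖c‖ := by
    have hca := Complex.norm_mul_exp_arg_mul_I c
    have h1 := Complex.neg_pi_lt_arg c
    have h2 := Complex.arg_le_pi c
    generalize c.arg = a at hca h1 h2
    have hdC : (d : ℂ) ≠ 0 := by exact_mod_cast hd0.ne'
    rcases le_total 0 a with ha | ha
    · refine ⟨(Real.pi - a) / d, ?_, ?_, ?_⟩
      · have : 0 ≤ (Real.pi - a) / d := div_nonneg (by linarith) hd0.le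
        linarith [Real.pi_pos]
      · rw [div_le_div_iff₀ hd0 two_pos]; nlinarith [Real.pi_pos]
      · conv_lhs => rw [← hca]
        rw [mul_assoc, ← Complex.exp_add]
        have : (a : ℂ) * Complex.I + d * (((Real.pi - a) / d : ℝ) * Complex.I)
          = Real.pi * Complex.I := by push_cast; field_simp; ring
        rw [this, Complex.exp_pi_mul_I]; ring
    · refine ⟨(-Real.pi - a) / d, ?_, ?_, ?_⟩
      · rw [← neg_div, div_le_div_iff₀ two_pos hd0]; nlinarith [Real.pi_pos]
      · have : (-Real.pi - a) / d ≤ 0 := div_nonpos_of_nonpos_of_nonneg (by linarith) hd0.le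
        linarith [Real.pi_pos]
      · conv_lhs => rw [← hca]
        rw [mul_assoc, ← Complex.exp_add]
        have : (a : ℂ) * Complex.I + d * (((-Real.pi - a) / d : ℝ) * Complex.I)
          = -(Real.pi * Complex.I) := by push_cast; field_simp; ring
        rw [this, Complex.exp_neg, Complex.exp_pi_mul_I]; norm_num
  set e := Complex.exp (θ * Complex.I) with he
  have hen : ‖e‖ = 1 := Complex.norm_exp_ofReal_mul_I θ
  have he0 : e ≠ 0 := Complex.exp_ne_zero _
  have hray : Tendsto (fun r : ℝ => (r : ℂ) * e) atTop (Bornology.cobounded ℂ) := by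
    rw [← tendsto_norm_atTop_iff_cobounded]
    simpa [hen] using tendsto_abs_atTop_atTop
  have hl := (hlim.comp hray).mul_const (e ^ d)
  rw [he, ← Complex.exp_int_mul, hθ] at hl
  have hre := (Complex.continuous_re.tendsto _).comp hl
  have hneg : (-(‖c‖ : ℂ)).re < 0 := by simpa using hc
  obtain ⟨r, h1, h2, hr⟩ := ((hre.eventually_lt_const hneg).and
    ((hray.eventually h).and (eventually_gt_atTop 0))).exists
  have hcos : 0 ≤ ((r : ℂ) * e).re := by
    rw [Complex.re_ofReal_mul, he, Complex.exp_ofReal_mul_I_re]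
    exact mul_nonneg hr.le (Real.cos_nonneg_of_neg_pi_div_two_le_of_le hθ1 hθ2)
  have h3 := h2 hcos
  simp only [Function.comp_apply] at h1
  rw [Complex.exp_int_mul, ← he] at h1
  have h4 : ((r : ℂ) * e) ^ (-d) * val (r * e) f * e ^ d = ((r ^ (-d) : ℝ) : ℂ) * val (r * e) f := by
    rw [mul_zpow, zpow_neg e]
    have := zpow_ne_zero d he0
    push_cast
    field_simp
  rw [h4, Complex.re_ofReal_mul] at h1
  exact absurd h1 (not_lt.2 (mul_nonneg (zpow_nonneg hr.le _) h3))

theorem tendsto_zpow_cobounded {k : ℤ} (hk : k ≤ 0) :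
    ∃ c : ℂ, Tendsto (fun s : ℂ => s ^ k) (Bornology.cobounded ℂ) (𝓝 c) := by
  obtain ⟨j, rfl⟩ := Int.exists_eq_neg_ofNat hk
  refine ⟨0 ^ j, ?_⟩
  simpa [zpow_neg, ← inv_pow] using (tendsto_inv₀_cobounded (α := ℂ)).pow j

theorem exists_tendsto_of_intDegree_le {f : RatFunc ℂ} {k : ℤ} (h : f.intDegree ≤ k) :
    ∃ c : ℂ, Tendsto (fun s => s ^ (-k) * val s f) (Bornology.cobounded ℂ) (𝓝 c) := by
  by_cases hf : f = 0
  · exact ⟨0, by simp [hf, val]⟩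
  obtain ⟨c, -, hc⟩ := exists_tendsto_zpow_mul_val hf
  obtain ⟨b, hb⟩ := tendsto_zpow_cobounded (k := f.intDegree - k) (by lia)
  refine ⟨b * c, (hb.mul hc).congr' ?_⟩
  filter_upwards [Bornology.eventually_ne_cobounded (0 : ℂ)] with s hs
  rw [← mul_assoc, ← zpow_add₀ hs]
  congr 2
  ring

theorem intDegree_nonpos_of_tendsto_zero {f : RatFunc ℂ}
    (h : Tendsto (fun s => s ^ (-1 : ℤ) * val s f) (Bornology.cobounded ℂ) (𝓝 0)) :
    f.intDegree ≤ 0 := by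
  by_contra! hd
  have hf : f ≠ 0 := by rintro rfl; simp at hd
  obtain ⟨c, hc0, hc⟩ := exists_tendsto_zpow_mul_val hf
  obtain ⟨b, hb⟩ := tendsto_zpow_cobounded (k := 1 - f.intDegree) (by lia)
  have h1 := hb.mul h
  rw [mul_zero] at h1
  refine hc0 (tendsto_nhds_unique hc (h1.congr' ?_))
  filter_upwards [Bornology.eventually_ne_cobounded (0 : ℂ)] with s hs
  rw [← mul_assoc, ← zpow_add₀ hs]
  congr 2
  ring

/-- A proper rational function without poles in a closed half plane is bounded there. -/
theorem exists_norm_val_le {f : RatFunc ℂ} {a : ℝ} (hf : ∀ s : ℂ, a ≤ s.re → f ∈ regularAt s)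
    (hd : f.intDegree ≤ 0) : ∃ b : ℝ, ∀ s : ℂ, a ≤ s.re → ‖val s f‖ ≤ b := by
  obtain ⟨c, hc⟩ := exists_tendsto_of_intDegree_le hd
  simp only [neg_zero, zpow_zero, one_mul] at hc
  have h1 : ∀ᶠ s in Bornology.cobounded ℂ, ‖val s f‖ ≤ ‖c‖ + 1 :=
    (hc.norm.eventually_lt_const (lt_add_one _)).mono fun _ h => h.le
  obtain ⟨r, -, hr⟩ := (Metric.hasBasis_cobounded_compl_closedBall (0 : ℂ)).eventually_iff.1 h1
  have hK : IsCompact (Metric.closedBall (0 : ℂ) r ∩ {s : ℂ | a ≤ s.re}) :=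
    (isCompact_closedBall _ _).inter_right (isClosed_le continuous_const Complex.continuous_re)
  obtain ⟨b, hb⟩ := hK.exists_bound_of_continuousOn (f := fun s => val s f)
    fun s hs => (analyticAt_val (hf s hs.2)).continuousAt.continuousWithinAt
  refine ⟨max b (‖c‖ + 1), fun s hs => ?_⟩
  by_cases hsr : s ∈ Metric.closedBall (0 : ℂ) r
  · exact (hb s ⟨hsr, hs⟩).trans (le_max_left _ _)
  · exact (hr hsr).trans (le_max_right _ _)

/-! ### Rational matrices regular at a point -/

section RationalMatrices

variable {p q r : Type*}

/-- All entries of the rational matrix `H` are regular at `z`. -/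
def RegularMat (z : ℂ) (H : Matrix p q (RatFunc ℂ)) : Prop := ∀ i j, H i j ∈ regularAt z

/-- The entrywise value at `z` of a possibly rectangular rational matrix; for square matrices this
is `valueAt`. -/
def matVal (z : ℂ) (H : Matrix p q (RatFunc ℂ)) : Matrix p q ℂ := H.map (val z)

theorem valueAt_eq_matVal {m : ℕ} (H : TransferMatrix m) (z : ℂ) : valueAt H z = matVal z H := rfl

theorem val_sum {ι : Type*} {z : ℂ} (s : Finset ι) {f : ι → RatFunc ℂ}
    (h : ∀ i, f i ∈ regularAt z) : val z (∑ i ∈ s, f i) = ∑ i ∈ s, val z (f i) := by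
  have := map_sum (evalHom z) (fun i => (⟨f i, h i⟩ : regularAt z)) s
  simpa only [evalHom_apply, AddSubmonoidClass.coe_finsetSum] using this

theorem regularMat_constMat (z : ℂ) (M : Matrix p q ℂ) : RegularMat z (constMat M) :=
  fun _ _ => C_mem_regularAt _ _

theorem matVal_constMat (z : ℂ) (M : Matrix p q ℂ) : matVal z (constMat M) = M := by
  ext i j; simp [matVal, constMat, val]

theorem RegularMat.add {z : ℂ} {H K : Matrix p q (RatFunc ℂ)} (hH : RegularMat z H)
    (hK : RegularMat z K) : RegularMat z (H + K) := fun i j => add_mem (hH i j) (hK i j)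

theorem RegularMat.sub {z : ℂ} {H K : Matrix p q (RatFunc ℂ)} (hH : RegularMat z H)
    (hK : RegularMat z K) : RegularMat z (H - K) := fun i j => sub_mem (hH i j) (hK i j)

theorem RegularMat.X_smul {z : ℂ} {H : Matrix p q (RatFunc ℂ)} (hH : RegularMat z H) :
    RegularMat z ((RatFunc.X : RatFunc ℂ) • H) :=
  fun i j => mul_mem (X_mem_regularAt z) (hH i j)

theorem RegularMat.mul [Fintype q] {z : ℂ} {H : Matrix p q (RatFunc ℂ)}
    {K : Matrix q r (RatFunc ℂ)} (hH : RegularMat z H) (hK : RegularMat z K) :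
    RegularMat z (H * K) :=
  fun i j => sum_mem fun k _ => mul_mem (hH i k) (hK k j)

theorem RegularMat.matVal_add {z : ℂ} {H K : Matrix p q (RatFunc ℂ)} (hH : RegularMat z H)
    (hK : RegularMat z K) : matVal z (H + K) = matVal z H + matVal z K := by
  ext i j; exact val_add (hH i j) (hK i j)

theorem RegularMat.matVal_sub {z : ℂ} {H K : Matrix p q (RatFunc ℂ)} (hH : RegularMat z H)
    (hK : RegularMat z K) : matVal z (H - K) = matVal z H - matVal z K := by
  ext i j; exact val_sub (hH i j) (hK i j)

theorem RegularMat.matVal_X_smul {z : ℂ} {H : Matrix p q (RatFunc ℂ)} (hH : RegularMat z H) :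
    matVal z ((RatFunc.X : RatFunc ℂ) • H) = z • matVal z H := by
  ext i j
  refine (val_mul (X_mem_regularAt z) (hH i j)).trans ?_
  simp [val, matVal]

theorem RegularMat.matVal_mul [Fintype q] {z : ℂ} {H : Matrix p q (RatFunc ℂ)}
    {K : Matrix q r (RatFunc ℂ)} (hH : RegularMat z H) (hK : RegularMat z K) :
    matVal z (H * K) = matVal z H * matVal z K := by
  ext i j
  refine (val_sum Finset.univ fun k => mul_mem (hH i k) (hK k j)).trans ?_
  exact Finset.sum_congr rfl fun k _ => val_mul (hH i k) (hK k j)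

theorem eventually_regularMat [Finite p] [Finite q] (H : Matrix p q (RatFunc ℂ)) :
    ∀ᶠ s in cofinite, RegularMat s H :=
  eventually_all.2 fun i => eventually_all.2 fun j => eventually_mem_regularAt (H i j)

theorem RegularMat.tendsto {z : ℂ} {H : Matrix p q (RatFunc ℂ)} (hH : RegularMat z H) :
    Tendsto (fun s => matVal s H) (𝓝 z) (𝓝 (matVal z H)) :=
  tendsto_pi_nhds.2 fun i => tendsto_pi_nhds.2 fun j => (analyticAt_val (hH i j)).continuousAt

theorem not_isPole_iff {m : ℕ} {H : TransferMatrix m} {z : ℂ} : ¬ IsPole H z ↔ RegularMat z H := by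
  refine ⟨fun h i j => ?_, fun h => not_not.2 ⟨_, h.tendsto.mono_left nhdsWithin_le_nhds⟩⟩
  obtain ⟨M, hM⟩ := not_not.1 h
  exact mem_regularAt_of_tendsto (tendsto_pi_nhds.1 (tendsto_pi_nhds.1 hM i) j)

/-- A matrix of regular functions, as a matrix over the local ring. -/
def RegularMat.lift {z : ℂ} {H : Matrix p q (RatFunc ℂ)} (hH : RegularMat z H) :
    Matrix p q (regularAt z) := Matrix.of fun i j => ⟨H i j, hH i j⟩

theorem RegularMat.map_lift {z : ℂ} {H : Matrix p q (RatFunc ℂ)} (hH : RegularMat z H) :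
    hH.lift.map (regularAt z).subtype = H := rfl

variable [Fintype p] [DecidableEq p]

theorem RegularMat.val_det {z : ℂ} {H : Matrix p p (RatFunc ℂ)} (hH : RegularMat z H) :
    val z H.det = (matVal z H).det := by
  have h1 := (regularAt z).subtype.map_det hH.lift
  rw [RingHom.mapMatrix_apply, hH.map_lift] at h1
  have h2 := (evalHom z).map_det hH.lift
  rw [← h1]
  exact h2

theorem RegularMat.adjugate {z : ℂ} {H : Matrix p p (RatFunc ℂ)} (hH : RegularMat z H) :
    RegularMat z H.adjugate := by
  have := (regularAt z).subtype.map_adjugate hH.lift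
  simp only [RingHom.mapMatrix_apply, hH.map_lift] at this
  rw [← this]
  exact fun i j => (hH.lift.adjugate i j).2

theorem RegularMat.isUnit {z : ℂ} {H : Matrix p p (RatFunc ℂ)} (hH : RegularMat z H)
    (hu : IsUnit (matVal z H)) : IsUnit H := by
  rw [Matrix.isUnit_iff_isUnit_det, isUnit_iff_ne_zero, ← hH.val_det] at hu
  rw [Matrix.isUnit_iff_isUnit_det, isUnit_iff_ne_zero]
  intro h
  simp [h, val] at hu

theorem RegularMat.inv {z : ℂ} {H : Matrix p p (RatFunc ℂ)} (hH : RegularMat z H)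
    (hu : IsUnit (matVal z H)) : RegularMat z H⁻¹ := by
  rw [Matrix.isUnit_iff_isUnit_det, isUnit_iff_ne_zero, ← hH.val_det] at hu
  rw [Matrix.inv_def, Ring.inverse_eq_inv']
  exact fun i j => mul_mem (inv_mem_regularAt hu) (hH.adjugate i j)

theorem RegularMat.matVal_inv {z : ℂ} {H : Matrix p p (RatFunc ℂ)} (hH : RegularMat z H)
    (hu : IsUnit (matVal z H)) : matVal z H⁻¹ = (matVal z H)⁻¹ := by
  refine (Matrix.inv_eq_right_inv ?_).symm
  rw [← hH.matVal_mul (hH.inv hu),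
    Matrix.mul_nonsing_inv _ ((Matrix.isUnit_iff_isUnit_det _).1 (hH.isUnit hu))]
  ext i j
  by_cases h : i = j <;> simp [matVal, val, h, Matrix.one_apply]

theorem eventually_isUnit_matVal {H : Matrix p p (RatFunc ℂ)} (hH : IsUnit H) :
    ∀ᶠ s in cofinite, IsUnit (matVal s H) := by
  rw [Matrix.isUnit_iff_isUnit_det, isUnit_iff_ne_zero] at hH
  filter_upwards [eventually_val_ne_zero hH, eventually_regularMat H] with s hs hr
  rwa [Matrix.isUnit_iff_isUnit_det, isUnit_iff_ne_zero, ← hr.val_det]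

end RationalMatrices

theorem constMat_mul {p q r : Type*} [Fintype q] (M : Matrix p q ℂ) (N : Matrix q r ℂ) :
    constMat (M * N) = constMat M * constMat N := Matrix.map_mul

theorem constMat_one {p : Type*} [DecidableEq p] : constMat (1 : Matrix p p ℂ) = 1 :=
  Matrix.map_one _ (map_zero _) (map_one _)

/-! ### Matrices with positive definite Hermitian part -/

section HermitianPart

variable {p : Type*} [Fintype p] [DecidableEq p]

theorem isUnit_of_posDef_add_conjTranspose {N : Matrix p p ℂ} (h : (N + Nᴴ).PosDef) :
    IsUnit N := by
  rw [← Matrix.mulVec_injective_iff_isUnit]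
  refine (injective_iff_map_eq_zero N.mulVecLin).2 fun x hx => ?_
  by_contra hx0
  have h1 := h.dotProduct_mulVec_pos hx0
  have hx : N *ᵥ x = 0 := hx
  have h2 : star x ⬝ᵥ Nᴴ *ᵥ x = 0 := by
    rw [Matrix.dotProduct_mulVec, ← Matrix.star_mulVec, hx]; simp
  rw [Matrix.add_mulVec, dotProduct_add, hx, h2] at h1
  simp at h1

theorem posDef_inv_add_conjTranspose {N : Matrix p p ℂ} (h : (N + Nᴴ).PosDef) :
    (N⁻¹ + (N⁻¹)ᴴ).PosDef := by
  have hN := isUnit_of_posDef_add_conjTranspose h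
  have hd := (Matrix.isUnit_iff_isUnit_det _).1 hN
  have hdt := (Matrix.isUnit_iff_isUnit_det _).1 hN.star
  rw [Matrix.star_eq_conjTranspose] at hdt
  have h1 : N⁻¹ + (N⁻¹)ᴴ = N⁻¹ * (N + Nᴴ) * (N⁻¹)ᴴ := by
    rw [Matrix.conjTranspose_nonsing_inv, mul_add, add_mul, Matrix.nonsing_inv_mul _ hd, mul_assoc,
      Matrix.mul_nonsing_inv _ hdt, one_mul, mul_one, add_comm]
  rw [h1]
  refine h.mul_mul_conjTranspose_same ?_
  rw [Matrix.vecMul_injective_iff_isUnit]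
  exact (Matrix.isUnit_nonsing_inv_iff).2 hN

theorem re_dotProduct_nonneg {q : Type*} [Fintype q] {N : Matrix q q ℂ} (h : (N + Nᴴ).PosDef)
    (x : q → ℂ) :
    0 ≤ (star x ⬝ᵥ N *ᵥ x).re := by
  have h1 := h.posSemidef.dotProduct_mulVec_nonneg x
  have h2 : star x ⬝ᵥ Nᴴ *ᵥ x = star (star x ⬝ᵥ N *ᵥ x) := by
    rw [Matrix.dotProduct_mulVec, ← Matrix.star_mulVec, Matrix.star_dotProduct]
  rw [Matrix.add_mulVec, dotProduct_add, h2, Complex.le_def] at h1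
  have := h1.1
  simp at this
  linarith

/-- A scalar matrix that dominates the entries of a Hermitian matrix makes it positive definite. -/
theorem posDef_add_smul_one {A : Matrix p p ℂ} (hA : A.IsHermitian) {b k : ℝ}
    (hb : ∀ i j, ‖A i j‖ ≤ b) (hk : Fintype.card p * b < k) :
    (A + (k : ℂ) • (1 : Matrix p p ℂ)).PosDef := by
  have hH : (A + (k : ℂ) • (1 : Matrix p p ℂ)).IsHermitian := by
    refine hA.add ?_
    simp [Matrix.IsHermitian, Matrix.conjTranspose_smul]
  refine Matrix.PosDef.of_dotProduct_mulVec_pos hH fun x hx => ?_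
  have him : (star x ⬝ᵥ (A + (k : ℂ) • (1 : Matrix p p ℂ)) *ᵥ x).im = 0 :=
    hH.im_star_dotProduct_mulVec_self x
  rw [Complex.lt_def]
  refine ⟨?_, him.symm⟩
  have hb0 : 0 ≤ b := by
    obtain ⟨i, -⟩ := Function.ne_iff.1 hx
    exact (norm_nonneg _).trans (hb i i)
  set t : ℝ := ∑ i, ‖x i‖ ^ 2 with ht
  have ht0 : 0 < t := by
    obtain ⟨i, hi⟩ := Function.ne_iff.1 hx
    have hi : x i ≠ 0 := hi
    exact Finset.sum_pos' (fun _ _ => by positivity) ⟨i, Finset.mem_univ _, by positivity⟩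
  have h1 : ‖star x ⬝ᵥ A *ᵥ x‖ ≤ Fintype.card p * b * t := by
    have h2 : ‖star x ⬝ᵥ A *ᵥ x‖ ≤ b * (∑ i, ‖x i‖) ^ 2 := by
      rw [sq, Finset.sum_mul_sum, Finset.mul_sum]
      refine (norm_sum_le _ _).trans (Finset.sum_le_sum fun i _ => ?_)
      rw [norm_mul, Finset.mul_sum]
      refine (mul_le_mul_of_nonneg_left (norm_sum_le _ _) (norm_nonneg _)).trans ?_
      rw [Finset.mul_sum]
      refine Finset.sum_le_sum fun j _ => ?_
      rw [norm_mul, Pi.star_apply, norm_star]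
      have := mul_le_mul_of_nonneg_right (hb i j)
        (mul_nonneg (norm_nonneg (x i)) (norm_nonneg (x j)))
      linarith
    have h3 := sq_sum_le_card_mul_sum_sq (s := Finset.univ) (f := fun i => ‖x i‖)
    rw [Finset.card_univ] at h3
    have := mul_le_mul_of_nonneg_left h3 hb0
    linarith
  have h4 : star x ⬝ᵥ x = (t : ℂ) := by
    simp [dotProduct, ht, Complex.conj_mul']
  rw [Matrix.add_mulVec, dotProduct_add, Matrix.smul_mulVec, Matrix.one_mulVec, dotProduct_smul, h4,
    smul_eq_mul, ← Complex.ofReal_mul, Complex.add_re, Complex.ofReal_re, Complex.zero_re]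
  have h5 := (abs_le.1 (Complex.abs_re_le_norm (star x ⬝ᵥ A *ᵥ x))).1
  have := mul_lt_mul_of_pos_right hk ht0
  linarith

end HermitianPart

/-! ### Necessity: the inverse of a strictly positive real matrix -/

/-- The quadratic form `xᴴ F x` of a rational matrix. -/
def quad {m : ℕ} (F : TransferMatrix m) (x : Fin m → ℂ) : RatFunc ℂ :=
  ∑ i, ∑ j, (star (x i) * x j) • F i j

theorem val_quad {m : ℕ} {F : TransferMatrix m} {z : ℂ} (hF : RegularMat z F) (x : Fin m → ℂ) :
    val z (quad F x) = star x ⬝ᵥ matVal z F *ᵥ x := by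
  have h0 (i j) : (star (x i) * x j) • F i j ∈ regularAt z := by
    rw [RatFunc.smul_eq_C_mul]; exact mul_mem (C_mem_regularAt _ _) (hF i j)
  rw [quad, val_sum _ fun i => sum_mem fun j _ => h0 i j]
  refine Finset.sum_congr rfl fun i _ => ?_
  rw [val_sum _ fun j => h0 i j, Matrix.mulVec, dotProduct, Finset.mul_sum]
  refine Finset.sum_congr rfl fun j _ => ?_
  rw [RatFunc.smul_eq_C_mul, val_mul (C_mem_regularAt _ _) (hF i j)]
  rw [val, RatFunc.eval_C, RingHom.id_apply]
  change star (x i) * x j * val z (F i j) = star (x i) * (val z (F i j) * x j)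
  ring

/-- Polarization: the quadratic form of a matrix determines its entries linearly. -/
theorem entry_mem_of_quad_mem {m : ℕ} {F : TransferMatrix m} (V : Submodule ℂ (RatFunc ℂ))
    (h : ∀ x, quad F x ∈ V) (a b : Fin m) : F a b ∈ V := by
  let B (x y : Fin m → ℂ) : RatFunc ℂ := ∑ i, ∑ j, (star (x i) * y j) • F i j
  have hadd (x y : Fin m → ℂ) :
      quad F (x + y) = quad F x + quad F y + B x y + B y x := by
    simp only [quad, B, ← Finset.sum_add_distrib, ← add_smul]
    refine Finset.sum_congr rfl fun i _ => Finset.sum_congr rfl fun j _ => ?_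
    congr 1
    simp only [Pi.add_apply, star_add]
    ring
  have hs (i j : Fin m) (c d : ℂ) :
      B (Pi.single i c) (Pi.single j d) = (star c * d) • F i j := by
    simp only [B]
    rw [Finset.sum_eq_single i, Finset.sum_eq_single j]
    · simp
    · intro k _ hk; simp [hk]
    · simp
    · intro k _ hk; simp [hk]
    · simp
  have h1 (c : ℂ) : c • F a b + star c • F b a ∈ V := by
    have := V.sub_mem (V.sub_mem (h (Pi.single a 1 + Pi.single b c)) (h (Pi.single a 1)))
      (h (Pi.single b c))
    rw [hadd, hs, hs] at this
    simpa [add_assoc] using this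
  have h2 := V.sub_mem (h1 1) (V.smul_mem Complex.I (h1 Complex.I))
  have h3 : (1 : ℂ) • F a b + star (1 : ℂ) • F b a -
      Complex.I • (Complex.I • F a b + star Complex.I • F b a) = (2 : ℂ) • F a b := by
    rw [smul_add, smul_smul, smul_smul, Complex.star_def, Complex.conj_I, mul_neg,
      Complex.I_mul_I, map_one]
    module
  rw [h3] at h2
  simpa using V.smul_mem (2⁻¹ : ℂ) h2

/-- The rational functions regular at `z`, as a complex vector space. -/
def regularSubmodule (z : ℂ) : Submodule ℂ (RatFunc ℂ) where
  carrier := regularAt z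
  add_mem' := add_mem
  zero_mem' := zero_mem _
  smul_mem' c f hf := by
    rw [RatFunc.smul_eq_C_mul]; exact mul_mem (C_mem_regularAt _ _) hf

/-- The rational functions of growth at most linear at infinity, as a complex vector space. -/
def linearGrowth : Submodule ℂ (RatFunc ℂ) where
  carrier := {f | f.intDegree ≤ 1}
  add_mem' {f g} hf hg := by
    have hf : f.intDegree ≤ 1 := hf
    have hg : g.intDegree ≤ 1 := hg
    by_cases h : f + g = 0
    · simp [h]
    by_cases h' : g = 0
    · simpa [h'] using hf
    exact (RatFunc.intDegree_add_le h' h).trans (max_le hf hg)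
  zero_mem' := by simp
  smul_mem' c f hf := by
    have hf : f.intDegree ≤ 1 := hf
    by_cases hc : c = 0
    · simp [hc]
    by_cases h : f = 0
    · simp [h]
    change (c • f).intDegree ≤ 1
    rw [RatFunc.smul_eq_C_mul, RatFunc.intDegree_mul (by simpa using hc) h]
    simpa using hf

theorem mem_linearGrowth {f : RatFunc ℂ} : f ∈ linearGrowth ↔ f.intDegree ≤ 1 := Iff.rfl

/-- The inverse of a strictly positive real matrix is positive real with a margin, so that it has
no finite pole in the closed right half plane and grows at most linearly. -/
theorem IsSPR.inverse {m : ℕ} {H : TransferMatrix m} (h : IsSPR H) :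
    IsUnit H ∧ (∀ z : ℂ, 0 ≤ z.re → RegularMat z H⁻¹) ∧ ∀ i j, H⁻¹ i j ∈ linearGrowth := by
  obtain ⟨ε, hε, h⟩ := h
  have hnear (z : ℂ) (hz : 0 ≤ z.re) : ∀ᶠ s in 𝓝[≠] z, -ε ≤ s.re := by
    refine Eventually.filter_mono nhdsWithin_le_nhds ?_
    exact (Complex.continuous_re.tendsto z).eventually (Ici_mem_nhds (by linarith))
  have hpos : ∀ᶠ s in cofinite, -ε ≤ s.re → (matVal s H + (matVal s H)ᴴ).PosDef := by
    filter_upwards [eventually_regularMat H] with s hs hr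
    exact h s hr (not_isPole_iff.2 hs)
  have hU : IsUnit H := by
    have h0 := (hpos.and (eventually_regularMat H)).filter_mono (nhdsNE_le_cofinite (0 : ℂ))
    obtain ⟨s, h1, h2, h3⟩ := ((hnear 0 le_rfl).and h0).exists
    exact RegularMat.isUnit h3 (isUnit_of_posDef_add_conjTranspose (h2 h1))
  have hre (x : Fin m → ℂ) : ∀ᶠ s in cofinite, -ε ≤ s.re →
      0 ≤ (val s (quad H⁻¹ x)).re := by
    filter_upwards [eventually_regularMat H, hpos, eventually_isUnit_matVal hU] with s h1 h2 h3 hr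
    rw [val_quad (h1.inv h3), h1.matVal_inv h3]
    exact re_dotProduct_nonneg (posDef_inv_add_conjTranspose (h2 hr)) x
  refine ⟨hU, fun z hz => ?_, ?_⟩
  · refine entry_mem_of_quad_mem (regularSubmodule z) fun x => ?_
    refine mem_regularAt_of_re_nonneg ?_
    filter_upwards [hnear z hz, nhdsNE_le_cofinite z (hre x)] with s h1 h2 using h2 h1
  · refine entry_mem_of_quad_mem linearGrowth fun x => intDegree_le_one_of_re_nonneg ?_
    filter_upwards [Bornology.le_cofinite ℂ (hre x)] with s hs hr
    exact hs (by linarith)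

/-! ### Matrices over the scalar field of the system -/

section ScalarField

variable {𝕜 : Type*} [RCLike 𝕜] {p q r : Type*}

/-- The embedding of the scalar field into `ℂ`, as a ring homomorphism. -/
def toCHom (𝕜 : Type*) [RCLike 𝕜] : 𝕜 →+* ℂ where
  toFun := RCLike.map 𝕜 ℂ
  map_one' := by simp
  map_zero' := by simp
  map_mul' x y := by
    apply Complex.ext <;> simp [RCLike.mul_re, RCLike.mul_im]
  map_add' := map_add _

theorem toC_eq_map (M : Matrix p q 𝕜) : toC M = M.map (toCHom 𝕜) := rfl

theorem toCHom_ofReal (x : ℝ) : toCHom 𝕜 (x : 𝕜) = (x : ℂ) := by simp [toCHom]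

theorem toC_mul [Fintype q] (M : Matrix p q 𝕜) (N : Matrix q r 𝕜) :
    toC (M * N) = toC M * toC N := by
  simp only [toC_eq_map, Matrix.map_mul]

theorem toC_add (M N : Matrix p q 𝕜) : toC (M + N) = toC M + toC N := by
  ext i j; simp [toC_eq_map]

theorem toC_sub (M N : Matrix p q 𝕜) : toC (M - N) = toC M - toC N := by
  ext i j; simp [toC_eq_map]

theorem toC_ofReal_smul (x : ℝ) (M : Matrix p q 𝕜) :
    toC ((x : 𝕜) • M) = (x : ℂ) • toC M := by
  ext i j
  change toCHom 𝕜 ((x : 𝕜) * M i j) = (x : ℂ) * toCHom 𝕜 (M i j)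
  rw [map_mul, toCHom_ofReal]

theorem toC_one [DecidableEq p] : toC (1 : Matrix p p 𝕜) = 1 :=
  Matrix.map_one _ (map_zero (toCHom 𝕜)) (map_one (toCHom 𝕜))

theorem toC_conjTranspose (M : Matrix p q 𝕜) : toC Mᴴ = (toC M)ᴴ := by
  ext i j
  apply Complex.ext <;> simp [toC]

/-- Matrices over the scalar field are closed among the complex ones. -/
theorem exists_toC_eq_of_tendsto {ι : Type*} {l : Filter ι} [l.NeBot] {f : ι → Matrix p p ℂ}
    {M : Matrix p p ℂ} (hf : Tendsto f l (𝓝 M)) (h : ∀ᶠ i in l, ∃ N : Matrix p p 𝕜, toC N = f i) :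
    ∃ N : Matrix p p 𝕜, toC N = M := by
  have hc : IsClosed (Set.range (RCLike.map 𝕜 ℂ)) :=
    Submodule.closed_of_finiteDimensional (LinearMap.range (RCLike.map 𝕜 ℂ).toLinearMap)
  have h1 (i j : p) : M i j ∈ Set.range (RCLike.map 𝕜 ℂ) := by
    refine hc.mem_of_tendsto (tendsto_pi_nhds.1 (tendsto_pi_nhds.1 hf i) j) ?_
    filter_upwards [h] with s hs
    obtain ⟨N, hN⟩ := hs
    exact ⟨N i j, congrFun (congrFun hN i) j⟩
  choose N hN using h1
  exact ⟨Matrix.of N, by ext i j; exact hN i j⟩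

variable [Fintype p] [DecidableEq p]

theorem isUnit_toC_iff {M : Matrix p p 𝕜} : IsUnit (toC M) ↔ IsUnit M := by
  rw [Matrix.isUnit_iff_isUnit_det, Matrix.isUnit_iff_isUnit_det, toC_eq_map,
    ← RingHom.mapMatrix_apply, ← RingHom.map_det, isUnit_iff_ne_zero, isUnit_iff_ne_zero,
    _root_.map_ne_zero]

theorem toC_inv {M : Matrix p p 𝕜} (h : IsUnit M) : toC M⁻¹ = (toC M)⁻¹ := by
  refine (Matrix.inv_eq_right_inv ?_).symm
  rw [← toC_mul, Matrix.mul_nonsing_inv _ ((Matrix.isUnit_iff_isUnit_det _).1 h), toC_one]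

/-- Every square matrix becomes positive semidefinite after multiplication by a suitable invertible
matrix. With `M = X d Y`, where `X`, `Y` are invertible and `d` is diagonal, `T = Y⁻¹ c Xᴴ` turns
`M` into `X (d dᴴ) Xᴴ`. -/
theorem exists_mul_eq_mul_conjTranspose (M : Matrix p p 𝕜) :
    ∃ T N : Matrix p p 𝕜, IsUnit T ∧ M * T = N * Nᴴ := by
  obtain ⟨l, l', d, hM⟩ := Matrix.Pivot.exists_list_transvec_mul_diagonal_mul_list_transvec M
  set X := (l.map Matrix.TransvectionStruct.toMatrix).prod with hX
  set Y := (l'.map Matrix.TransvectionStruct.toMatrix).prod with hY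
  have hXu : IsUnit X.det := by simp [hX]
  have hYu : IsUnit Y.det := by simp [hY]
  -- Where `d` vanishes the value of `c` only has to be nonzero.
  let c : p → 𝕜 := fun i => if d i = 0 then 1 else star (d i)
  have hc : IsUnit (Matrix.diagonal c) := by
    rw [Matrix.isUnit_iff_isUnit_det, Matrix.det_diagonal, isUnit_iff_ne_zero,
      Finset.prod_ne_zero_iff]
    intro i _
    by_cases h : d i = 0 <;> simp [c, h]
  have hdc : Matrix.diagonal d * Matrix.diagonal c = Matrix.diagonal d * (Matrix.diagonal d)ᴴ := by
    rw [Matrix.diagonal_conjTranspose, Matrix.diagonal_mul_diagonal, Matrix.diagonal_mul_diagonal]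
    congr 1
    ext i
    by_cases h : d i = 0 <;> simp [c, h]
  refine ⟨Y⁻¹ * Matrix.diagonal c * Xᴴ, X * Matrix.diagonal d, ?_, ?_⟩
  · have h1 : IsUnit Y⁻¹ := Matrix.isUnit_nonsing_inv_iff.2 ((Matrix.isUnit_iff_isUnit_det _).2 hYu)
    have h2 : IsUnit Xᴴ := ((Matrix.isUnit_iff_isUnit_det _).2 hXu).star
    exact (h1.mul hc).mul h2
  · calc M * (Y⁻¹ * Matrix.diagonal c * Xᴴ)
        = X * Matrix.diagonal d * (Y * Y⁻¹) * Matrix.diagonal c * Xᴴ := by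
          rw [hM]; simp only [mul_assoc]
      _ = X * (Matrix.diagonal d * Matrix.diagonal c) * Xᴴ := by
          rw [Matrix.mul_nonsing_inv _ hYu, mul_one]; simp only [mul_assoc]
      _ = _ := by rw [hdc, Matrix.conjTranspose_mul]; simp only [mul_assoc]

/-- `det (1 + k M)` is a polynomial in `k` with constant term `1`, so it is nonzero for arbitrarily
large real `k`. -/
theorem exists_gt_isUnit_one_add_smul (M : Matrix p p 𝕜) (b : ℝ) :
    ∃ k : ℝ, b < k ∧ IsUnit (1 + (k : 𝕜) • M) := by
  have h0 : (-M).charpolyRev ≠ 0 := by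
    intro h
    have := Matrix.eval_charpolyRev (M := -M)
    simp [h] at this
  have hfin := (finite_setOfPred_isRoot h0).preimage
    (RCLike.ofReal_injective (K := 𝕜)).injOn
  obtain ⟨k, hk, hkr⟩ := ((Set.Ioi_infinite b).sdiff hfin).nonempty
  refine ⟨k, hk, ?_⟩
  rw [Matrix.isUnit_iff_isUnit_det, isUnit_iff_ne_zero]
  intro h
  apply hkr
  change (-M).charpolyRev.eval (k : 𝕜) = 0
  rw [Matrix.charpolyRev, ← coe_evalRingHom, RingHom.map_det, ← h]
  congr 1
  ext i j
  have h1 : ((1 : Matrix p p 𝕜[X]) i j).eval (k : 𝕜) = (1 : Matrix p p 𝕜) i j := by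
    rw [Matrix.one_apply, Matrix.one_apply]
    split_ifs <;> simp
  simp only [coe_evalRingHom, RingHom.mapMatrix_apply, Matrix.map_apply, Matrix.sub_apply,
    Matrix.smul_apply, Matrix.neg_apply, Matrix.add_apply, smul_eq_mul, eval_sub, eval_mul, eval_X,
    eval_C, h1]
  ring

end ScalarField

/-! ### The transfer function and its inverse -/

namespace DescriptorSystem

variable {𝕜 : Type*} [RCLike 𝕜] {n m : ℕ} (S : DescriptorSystem 𝕜 n m)

/-- The pencil `s E - A` as a rational matrix. -/
def pencil : Matrix (Fin n) (Fin n) (RatFunc ℂ) :=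
  (RatFunc.X : RatFunc ℂ) • constMat (toC S.E) - constMat (toC S.A)

theorem regularMat_pencil (z : ℂ) : RegularMat z S.pencil :=
  (regularMat_constMat z _).X_smul.sub (regularMat_constMat z _)

theorem matVal_pencil (z : ℂ) : matVal z S.pencil = z • toC S.E - toC S.A := by
  rw [pencil, (regularMat_constMat z _).X_smul.matVal_sub (regularMat_constMat z _),
    (regularMat_constMat z _).matVal_X_smul, matVal_constMat, matVal_constMat]

theorem isUnit_pencil (hS : S.IsRegular) : IsUnit S.pencil := by
  obtain ⟨s, hs⟩ := hS
  refine (S.regularMat_pencil s).isUnit ?_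
  rwa [matVal_pencil, Matrix.isUnit_iff_isUnit_det, isUnit_iff_ne_zero]

theorem transfer_eq : S.transfer =
    constMat (toC S.C) * S.pencil⁻¹ * constMat (toC S.B) + constMat (toC S.D) := rfl

/-- On the real axis the inverse of the transfer function takes values over the scalar field. -/
theorem eventually_exists_toC_eq (hS : S.IsRegular) (hG : IsUnit S.transfer) :
    ∀ᶠ s : ℂ in Bornology.cobounded ℂ, ∀ r : ℝ, s = (r : ℂ) →
      ∃ N : Matrix (Fin m) (Fin m) 𝕜, toC N = matVal s S.transfer⁻¹ := by
  filter_upwards [Bornology.le_cofinite ℂ (eventually_isUnit_matVal (S.isUnit_pencil hS)),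
    Bornology.le_cofinite ℂ (eventually_isUnit_matVal hG),
    Bornology.le_cofinite ℂ (eventually_regularMat S.transfer)] with s h1 h2 h3 r hr
  have hP : matVal s S.pencil = toC ((r : 𝕜) • S.E - S.A) := by
    rw [matVal_pencil, hr, toC_sub, toC_ofReal_smul]
  have hPi := (S.regularMat_pencil s).inv h1
  have hc {p q : Type} (M : Matrix p q ℂ) := regularMat_constMat s M
  have hPu : IsUnit ((r : 𝕜) • S.E - S.A) := by rwa [hP, isUnit_toC_iff] at h1
  have hGv : matVal s S.transfer = toC (S.C * ((r : 𝕜) • S.E - S.A)⁻¹ * S.B + S.D) := by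
    rw [transfer_eq, (((hc _).mul hPi).mul (hc _)).matVal_add (hc _),
      ((hc _).mul hPi).matVal_mul (hc _), (hc _).matVal_mul hPi,
      (S.regularMat_pencil s).matVal_inv h1, hP, toC_add, toC_mul, toC_mul, toC_inv hPu]
    simp only [matVal_constMat]
  rw [h3.matVal_inv h2, hGv]
  rw [hGv, isUnit_toC_iff] at h2
  exact ⟨_, toC_inv h2⟩

/-! ### Poles of the inverse and eigenvalues of the closed loop -/

/-- The matrix `W = G⁻¹ C (s E - A)⁻¹` is regular at every controllable point where `G⁻¹` is
regular: a right inverse of `[z E - A, B]` expresses `W` through `G⁻¹` near `z`. The conclusion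
states the identities that `W` satisfies at `z`. -/
theorem exists_mul_pencil_eq (hS : S.IsRegular) (hG : IsUnit S.transfer) {z : ℂ}
    (hz : RegularMat z S.transfer⁻¹) (hcon : ¬ S.IsUncontrollableEigenvalue z) :
    ∃ W : Matrix (Fin m) (Fin n) ℂ,
      W * (z • toC S.E - toC S.A) = matVal z S.transfer⁻¹ * toC S.C ∧
      W * toC S.B = 1 - matVal z S.transfer⁻¹ * toC S.D := by
  obtain ⟨R, hR⟩ : ∃ R : Matrix (Fin n ⊕ Fin m) (Fin n) ℂ,
      Matrix.fromCols (z • toC S.E - toC S.A) (toC S.B) * R = 1 := by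
    rw [← Matrix.mulVec_surjective_iff_exists_right_inverse]
    rw [IsUncontrollableEigenvalue, not_lt] at hcon
    set F := Matrix.fromCols (z • toC S.E - toC S.A) (toC S.B)
    have h1 : LinearMap.range F.mulVecLin = ⊤ := ?_
    · exact LinearMap.range_eq_top.1 h1
    refine Submodule.eq_top_of_finrank_eq (le_antisymm (Submodule.finrank_le _) ?_)
    simpa [Matrix.rank] using hcon
  obtain ⟨X₀, Y₀, rfl⟩ : ∃ (X₀ : Matrix (Fin n) (Fin n) ℂ) (Y₀ : Matrix (Fin m) (Fin n) ℂ),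
      R = Matrix.fromRows X₀ Y₀ :=
    ⟨R.toRows₁, R.toRows₂, (Matrix.fromRows_toRows R).symm⟩
  rw [Matrix.fromCols_mul_fromRows] at hR
  have hc {p q : Type} (M : Matrix p q ℂ) := regularMat_constMat z M
  have hP := S.regularMat_pencil z
  set G := S.transfer with hGdef
  set J := S.pencil * constMat X₀ + constMat (toC S.B) * constMat Y₀ with hJ
  have hJr : RegularMat z J := (hP.mul (hc _)).add ((hc _).mul (hc _))
  have hJz : matVal z J = 1 := by
    rw [(hP.mul (hc _)).matVal_add ((hc _).mul (hc _)), hP.matVal_mul (hc _),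
      (hc _).matVal_mul (hc _), matVal_pencil, matVal_constMat, matVal_constMat,
      matVal_constMat, hR]
  have hJu : IsUnit (matVal z J) := by rw [hJz]; exact isUnit_one
  have hGd := (Matrix.isUnit_iff_isUnit_det _).1 hG
  have hPd := (Matrix.isUnit_iff_isUnit_det _).1 (S.isUnit_pencil hS)
  have hJd := (Matrix.isUnit_iff_isUnit_det _).1 (hJr.isUnit hJu)
  set W := G⁻¹ * constMat (toC S.C) * S.pencil⁻¹ with hW
  have hWP : W * S.pencil = G⁻¹ * constMat (toC S.C) := by
    rw [hW, Matrix.mul_assoc, Matrix.nonsing_inv_mul _ hPd, Matrix.mul_one]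
  have hWB : W * constMat (toC S.B) = 1 - G⁻¹ * constMat (toC S.D) := by
    have h1 : constMat (toC S.C) * S.pencil⁻¹ * constMat (toC S.B)
        = G - constMat (toC S.D) := by rw [hGdef, transfer_eq, add_sub_cancel_right]
    rw [hW, Matrix.mul_assoc, Matrix.mul_assoc, ← Matrix.mul_assoc (constMat (toC S.C)), h1,
      mul_sub, Matrix.nonsing_inv_mul _ hGd]
  have hone : (1 : Matrix (Fin m) (Fin m) (RatFunc ℂ)) = constMat 1 := constMat_one.symm
  have hWr : RegularMat z W := by
    have h1 : W = (G⁻¹ * constMat (toC S.C) * constMat X₀ +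
        (constMat 1 - G⁻¹ * constMat (toC S.D)) * constMat Y₀) * J⁻¹ := by
      rw [← hWP, ← hone, ← hWB, Matrix.mul_assoc W, Matrix.mul_assoc W, ← Matrix.mul_add, ← hJ,
        Matrix.mul_assoc W, Matrix.mul_nonsing_inv _ hJd, Matrix.mul_one]
    rw [h1]
    exact (((hz.mul (hc _)).mul (hc _)).add (((hc _).sub (hz.mul (hc _))).mul (hc _))).mul
      (hJr.inv hJu)
  refine ⟨matVal z W, ?_, ?_⟩
  · rw [← matVal_pencil, ← hWr.matVal_mul hP, hWP, hz.matVal_mul (hc _), matVal_constMat]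
  · have h1 := congrArg (matVal z) hWB
    rw [hWr.matVal_mul (hc _), hone, (hc _).matVal_sub (hz.mul (hc _)), hz.matVal_mul (hc _)] at h1
    simpa only [matVal_constMat] using h1

/-- A state `v` and an input `u` with `(z E - A) v = B u` give an output `C v + D u` on which
`G(z)⁻¹` takes the value `u`; the feedback `u = K y` then forces `u = 0`, so that `v` is
unobservable. -/
theorem not_isPairEigenvalue_closedLoop (hS : S.IsRegular) (hG : IsUnit S.transfer)
    {K : Matrix (Fin m) (Fin m) 𝕜} (hKD : IsUnit (1 - K * S.D)) {z : ℂ}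
    (hz : RegularMat z S.transfer⁻¹) (hu : IsUnit (matVal z S.transfer⁻¹ - toC K))
    (hcon : ¬ S.IsUncontrollableEigenvalue z) (hobs : ¬ S.IsUnobservableEigenvalue z) :
    ¬ IsPairEigenvalue (toC S.E) (toC (S.closedLoopA K)) z := by
  rintro ⟨v, hv, hzv⟩
  obtain ⟨W, hW1, hW2⟩ := S.exists_mul_pencil_eq hS hG hz hcon
  set Gi := matVal z S.transfer⁻¹
  have hKD' : IsUnit (1 - toC K * toC S.D) := by
    rwa [← toC_mul, ← toC_one (𝕜 := 𝕜), ← toC_sub, isUnit_toC_iff]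
  have hKDd := (Matrix.isUnit_iff_isUnit_det _).1 hKD'
  set u := (1 - toC K * toC S.D)⁻¹ *ᵥ (toC K *ᵥ (toC S.C *ᵥ v)) with hudef
  set y := toC S.C *ᵥ v + toC S.D *ᵥ u with hy
  have h1 : (z • toC S.E - toC S.A) *ᵥ v = toC S.B *ᵥ u := by
    have h2 : toC (S.closedLoopA K) = toC S.A +
        toC S.B * (1 - toC K * toC S.D)⁻¹ * toC K * toC S.C := by
      rw [closedLoopA, toC_add, toC_mul, toC_mul, toC_mul, toC_inv hKD, toC_sub, toC_one, toC_mul]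
    rw [h2, ← sub_sub, Matrix.sub_mulVec, sub_eq_zero] at hzv
    rw [hzv, hudef]
    simp only [Matrix.mulVec_mulVec, Matrix.mul_assoc]
  have h2 : u = toC K *ᵥ y := by
    have h3 : (1 - toC K * toC S.D) *ᵥ u = toC K *ᵥ (toC S.C *ᵥ v) := by
      rw [hudef, Matrix.mulVec_mulVec, Matrix.mul_nonsing_inv _ hKDd, Matrix.one_mulVec]
    rw [Matrix.sub_mulVec, Matrix.one_mulVec, sub_eq_iff_eq_add] at h3
    rw [hy, Matrix.mulVec_add, Matrix.mulVec_mulVec _ (toC K) (toC S.D)]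
    exact h3
  have h3 : Gi *ᵥ y = u := by
    have h4 := congrArg (W *ᵥ ·) h1
    simp only [Matrix.mulVec_mulVec] at h4
    rw [hW1, hW2, Matrix.sub_mulVec, Matrix.one_mulVec, ← Matrix.mulVec_mulVec,
      ← Matrix.mulVec_mulVec] at h4
    rw [hy, Matrix.mulVec_add, h4, sub_add_cancel]
  have hy0 : y = 0 := by
    refine Matrix.mulVec_injective_iff_isUnit.2 hu ?_
    rw [Matrix.mulVec_zero, Matrix.sub_mulVec, h3, ← h2, sub_self]
  have hu0 : u = 0 := by rw [h2, hy0, Matrix.mulVec_zero]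
  rw [hu0, Matrix.mulVec_zero] at h1
  rw [hu0, Matrix.mulVec_zero, add_zero] at hy
  apply hobs
  have hker : Matrix.fromRows (z • toC S.E - toC S.A) (toC S.C) *ᵥ v = 0 := by
    rw [Matrix.fromRows_mulVec, h1, ← hy, hy0]
    ext i; cases i <;> rfl
  rw [IsUnobservableEigenvalue]
  set F := Matrix.fromRows (z • toC S.E - toC S.A) (toC S.C)
  have hrn := F.mulVecLin.finrank_range_add_finrank_ker
  have hpos : 0 < Module.finrank ℂ (LinearMap.ker F.mulVecLin) := by
    rw [Module.finrank_pos_iff_exists_ne_zero]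
    exact ⟨⟨v, hker⟩, fun h => hv (congrArg Subtype.val h)⟩
  rw [Module.finrank_fin_fun] at hrn
  rw [Matrix.rank]
  lia

/-- The closed-loop pencil factors through `[z E - A, B]` and through `[z E - A; C]`, so these have
maximum rank wherever it is nonsingular. -/
theorem re_neg_of_isStablePair {K : Matrix (Fin m) (Fin m) 𝕜}
    (h : IsStablePair (toC S.E) (toC (S.closedLoopA K))) {z : ℂ}
    (hz : S.IsUncontrollableEigenvalue z ∨ S.IsUnobservableEigenvalue z) : z.re < 0 := by
  by_contra hre
  have hu : IsUnit (z • toC S.E - toC (S.closedLoopA K)) := by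
    rw [← Matrix.mulVec_injective_iff_isUnit]
    refine (injective_iff_map_eq_zero (Matrix.mulVecLin _)).2 fun v hv => ?_
    by_contra hv0
    exact hre (h z ⟨v, hv0, hv⟩)
  have hrank := Matrix.rank_of_isUnit _ hu
  rw [Fintype.card_fin] at hrank
  have hA : toC (S.closedLoopA K) =
      toC S.A + toC S.B * toC ((1 - K * S.D)⁻¹ * K) * toC S.C := by
    rw [closedLoopA, toC_add, toC_mul, Matrix.mul_assoc S.B, toC_mul]
  set Y := toC ((1 - K * S.D)⁻¹ * K)
  rcases hz with hz | hz
  · let F : Matrix (Fin n) (Fin n ⊕ Fin m) ℂ :=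
      Matrix.fromCols (z • toC S.E - toC S.A) (toC S.B)
    let R : Matrix (Fin n ⊕ Fin m) (Fin n) ℂ := Matrix.fromRows 1 (-(Y * toC S.C))
    have h1 : z • toC S.E - toC (S.closedLoopA K) = F * R := by
      simp only [F, R]
      rw [Matrix.fromCols_mul_fromRows, hA, Matrix.mul_one, Matrix.mul_neg, Matrix.mul_assoc]
      abel
    rw [h1] at hrank
    have := Matrix.rank_mul_le_left F R
    have hz : F.rank < n := hz
    lia
  · let F : Matrix (Fin n ⊕ Fin m) (Fin n) ℂ :=
      Matrix.fromRows (z • toC S.E - toC S.A) (toC S.C)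
    let R : Matrix (Fin n) (Fin n ⊕ Fin m) ℂ := Matrix.fromCols 1 (-(toC S.B * Y))
    have h1 : z • toC S.E - toC (S.closedLoopA K) = R * F := by
      simp only [F, R]
      rw [Matrix.fromCols_mul_fromRows, hA, Matrix.one_mul, Matrix.neg_mul]
      abel
    rw [h1] at hrank
    have := Matrix.rank_mul_le_right R F
    have hz : F.rank < n := hz
    lia

end DescriptorSystem

/-! ### Sufficiency: high-gain feedback -/

theorem HasScaledLimitAtInfinity.of_not_isPoleAtInfinity {m : ℕ} {H : TransferMatrix m}
    (h : ¬ IsPoleAtInfinity H) : HasScaledLimitAtInfinity H 1 := by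
  obtain ⟨M, hM⟩ := not_not.1 h
  obtain ⟨c, hc⟩ := tendsto_zpow_cobounded (k := -1) (by norm_num)
  exact ⟨c • M, hc.smul hM⟩

/-- There is a strip to the left of the imaginary axis without poles. -/
theorem exists_margin {m : ℕ} {H : TransferMatrix m}
    (h : ∀ z : ℂ, 0 ≤ z.re → RegularMat z H) :
    ∃ ε : ℝ, 0 < ε ∧ ∀ z : ℂ, -ε ≤ z.re → RegularMat z H := by
  have hfin : {z | ¬ RegularMat z H}.Finite := eventually_regularMat H
  have h1 : ∀ᶠ ε : ℝ in 𝓝[>] 0, ∀ z ∈ {z | ¬ RegularMat z H}, z.re < -ε := by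
    refine (eventually_all_finite hfin).2 fun z hz => ?_
    have hz0 : z.re < 0 := by
      by_contra! h0
      exact hz (h z h0)
    have h2 : ∀ᶠ ε : ℝ in 𝓝 0, ε < -z.re := eventually_lt_nhds (by linarith)
    exact (h2.filter_mono nhdsWithin_le_nhds).mono fun ε hε => by linarith
  obtain ⟨ε, h2, hε⟩ := (h1.and self_mem_nhdsWithin).exists
  refine ⟨ε, hε, fun z hz => ?_⟩
  by_contra h3
  have := h2 z h3
  linarith

/-- A rational matrix that is `o(s)` at infinity and has no poles in a closed half plane is bounded
there. -/
theorem exists_norm_matVal_le {m : ℕ} {Q : TransferMatrix m} {a : ℝ}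
    (hreg : ∀ s : ℂ, a ≤ s.re → RegularMat s Q)
    (hlim : Tendsto (fun s : ℂ => s ^ (-1 : ℤ) • matVal s Q) (Bornology.cobounded ℂ) (𝓝 0)) :
    ∃ b : ℝ, ∀ s : ℂ, a ≤ s.re → ∀ i j, ‖matVal s Q i j‖ ≤ b := by
  have h (x : Fin m × Fin m) : ∃ b : ℝ, ∀ s : ℂ, a ≤ s.re → ‖matVal s Q x.1 x.2‖ ≤ b :=
    exists_norm_val_le (fun s hs => hreg s hs x.1 x.2) (intDegree_nonpos_of_tendsto_zero
      (tendsto_pi_nhds.1 (tendsto_pi_nhds.1 hlim x.1) x.2))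
  choose b hb using h
  obtain ⟨c, hc⟩ := Finite.exists_le b
  exact ⟨c, fun s hs i j => (hb (i, j) s hs).trans (hc _)⟩

/-- If `N Nᴴ` is the limit of `F(s) / s` and `F` has no poles in a neighbourhood of the closed right
half plane, then `F + k` has positive definite Hermitian part there for all large `k`. -/
theorem exists_forall_gt_posDef {m : ℕ} {F : TransferMatrix m} {N : Matrix (Fin m) (Fin m) ℂ}
    {ε : ℝ} (hε : 0 < ε) (hreg : ∀ s : ℂ, -ε ≤ s.re → RegularMat s F)
    (hlim : Tendsto (fun s : ℂ => s ^ (-1 : ℤ) • matVal s F) (Bornology.cobounded ℂ)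
      (𝓝 (N * Nᴴ))) :
    ∃ b : ℝ, ∀ k : ℝ, b < k → ∀ s : ℂ, -ε ≤ s.re →
      (matVal s F + (k : ℂ) • 1 + (matVal s F + (k : ℂ) • 1)ᴴ).PosDef := by
  set R := N * Nᴴ with hR
  have hRH : Rᴴ = R := (Matrix.isHermitian_mul_conjTranspose_self N)
  set Q : TransferMatrix m := F - (RatFunc.X : RatFunc ℂ) • constMat R with hQ
  have hX (s : ℂ) := (regularMat_constMat s R).X_smul
  have hQv (s : ℂ) (hs : RegularMat s F) : matVal s Q = matVal s F - s • R := by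
    rw [hQ, hs.matVal_sub (hX s), (regularMat_constMat s R).matVal_X_smul, matVal_constMat]
  have hQlim : Tendsto (fun s : ℂ => s ^ (-1 : ℤ) • matVal s Q) (Bornology.cobounded ℂ) (𝓝 0) := by
    have h1 := hlim.sub_const R
    rw [sub_self] at h1
    refine h1.congr' ?_
    filter_upwards [Bornology.eventually_ne_cobounded (0 : ℂ),
      Bornology.le_cofinite ℂ (eventually_regularMat F)] with s hs hF
    rw [hQv s hF, smul_sub, smul_smul, zpow_neg_one, inv_mul_cancel₀ hs, one_smul]
  obtain ⟨b, hb⟩ := exists_norm_matVal_le (fun s hs => (hreg s hs).sub (hX s)) hQlim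
  obtain ⟨c, hc⟩ := Finite.exists_le fun x : Fin m × Fin m => ‖R x.1 x.2‖
  refine ⟨Fintype.card (Fin m) * (2 * b + 2 * ε * c), fun k hk s hs => ?_⟩
  have hb := hb s hs
  -- The part of slope `2 Re s + 2 ε` is semidefinite; what remains is bounded uniformly in `s`.
  have hsplit : matVal s F + (k : ℂ) • 1 + (matVal s F + (k : ℂ) • 1)ᴴ =
      ((matVal s Q + (matVal s Q)ᴴ - ((2 * ε : ℝ) : ℂ) • R) + ((2 * k : ℝ) : ℂ) • 1) +
        ((2 * (s.re + ε) : ℝ) : ℂ) • R := by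
    have h2 : s + star s = ((2 * s.re : ℝ) : ℂ) := by
      simpa using Complex.add_conj s
    rw [hQv s (hreg s hs)]
    simp only [Matrix.conjTranspose_add, Matrix.conjTranspose_sub, Matrix.conjTranspose_smul,
      Matrix.conjTranspose_one, hRH, Complex.star_def, Complex.conj_ofReal]
    rw [Complex.star_def] at h2
    have h3 : starRingEnd ℂ s = ((2 * s.re : ℝ) : ℂ) - s := by rw [← h2]; ring
    rw [h3]
    push_cast
    module
  have hA : (matVal s Q + (matVal s Q)ᴴ - ((2 * ε : ℝ) : ℂ) • R).IsHermitian := by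
    rw [Matrix.IsHermitian, Matrix.conjTranspose_sub, Matrix.conjTranspose_add,
      Matrix.conjTranspose_conjTranspose, Matrix.conjTranspose_smul, hRH, Complex.star_def,
      Complex.conj_ofReal, add_comm (matVal s Q)ᴴ]
  rw [hsplit]
  refine Matrix.PosDef.add_posSemidef (posDef_add_smul_one hA (b := 2 * b + 2 * ε * c)
    (fun i j => ?_) ?_) ?_
  · refine (norm_sub_le _ _).trans (add_le_add ((norm_add_le _ _).trans ?_) ?_)
    · rw [Matrix.conjTranspose_apply, norm_star]
      linarith [hb i j, hb j i]
    · rw [Matrix.smul_apply, smul_eq_mul, norm_mul, Complex.norm_real, Real.norm_eq_abs,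
        abs_of_pos (by positivity)]
      exact mul_le_mul_of_nonneg_left (hc (i, j)) (by positivity)
  · rcases isEmpty_or_nonempty (Fin m) with h | ⟨⟨i⟩⟩
    · simp at hk ⊢
      exact hk
    · have h1 : 0 ≤ b := (norm_nonneg _).trans (hb i i)
      have h2 : 0 ≤ c := (norm_nonneg _).trans (hc (i, i))
      have : 0 ≤ Fintype.card (Fin m) * (2 * b + 2 * ε * c) := by positivity
      linarith
  · refine (Matrix.posSemidef_self_mul_conjTranspose N).smul ?_
    rw [Complex.zero_le_real]
    linarith

namespace DescriptorSystem

variable {𝕜 : Type*} [RCLike 𝕜] {n m : ℕ} (S : DescriptorSystem 𝕜 n m)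

/-- The inverse of the closed-loop transfer function is affine in `G⁻¹`. -/
theorem closedLoopTransfer_eq_inv (hG : IsUnit S.transfer) {K T : Matrix (Fin m) (Fin m) 𝕜}
    (hT : IsUnit T) :
    S.closedLoopTransfer K T⁻¹ = ((S.transfer⁻¹ - constMat (toC K)) * constMat (toC T))⁻¹ := by
  have hGd := (Matrix.isUnit_iff_isUnit_det _).1 hG
  have hTd := (Matrix.isUnit_iff_isUnit_det _).1 hT
  have h1 : constMat (toC T⁻¹) = (constMat (toC T))⁻¹ := by
    refine (Matrix.inv_eq_right_inv ?_).symm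
    rw [← constMat_mul, ← toC_mul, Matrix.mul_nonsing_inv _ hTd, toC_one, constMat_one]
  have h2 : 1 - S.transfer * constMat (toC K) =
      S.transfer * (S.transfer⁻¹ - constMat (toC K)) := by
    rw [mul_sub, Matrix.mul_nonsing_inv _ hGd]
  rw [closedLoopTransfer, h1, h2, Matrix.mul_inv_rev, Matrix.mul_inv_rev, mul_assoc, mul_assoc,
    Matrix.nonsing_inv_mul _ hGd, mul_one]

/-- With `M` the limit of `G⁻¹(s) / s` and `M T = N Nᴴ`, the gains `L = T⁻¹` and `K = -k T⁻¹` achieve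
stability and strict positive realness for suitable large `k`. -/
theorem canBeMadeStableSPR (hS : S.IsRegular) (hG : IsUnit S.transfer)
    (hpole : ∀ z : ℂ, 0 ≤ z.re → RegularMat z S.transfer⁻¹)
    (hinf : HasScaledLimitAtInfinity S.transfer⁻¹ 1)
    (hc : ∀ z : ℂ, S.IsUncontrollableEigenvalue z ∨ S.IsUnobservableEigenvalue z → z.re < 0) :
    S.CanBeMadeStableSPR := by
  obtain ⟨M', hM⟩ := hinf
  simp only [valueAt_eq_matVal] at hM
  have hreal : Tendsto (fun r : ℝ => (r : ℂ)) atTop (Bornology.cobounded ℂ) := by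
    rw [← tendsto_norm_atTop_iff_cobounded]
    simpa using tendsto_abs_atTop_atTop
  -- The limit is attained along the real axis, where `G⁻¹` has values over the scalar field.
  obtain ⟨M, rfl⟩ : ∃ M : Matrix (Fin m) (Fin m) 𝕜, toC M = M' := by
    refine exists_toC_eq_of_tendsto (hM.comp hreal) ?_
    filter_upwards [hreal.eventually (S.eventually_exists_toC_eq hS hG)] with r hr
    obtain ⟨N, hN⟩ := hr r rfl
    refine ⟨((r⁻¹ : ℝ) : 𝕜) • N, ?_⟩
    rw [toC_ofReal_smul, hN, Function.comp_apply, zpow_neg_one, Complex.ofReal_inv]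
  obtain ⟨T, N, hT, hN⟩ := exists_mul_eq_mul_conjTranspose M
  have hTd := (Matrix.isUnit_iff_isUnit_det _).1 hT
  obtain ⟨ε, hε, hreg⟩ := exists_margin hpole
  have hcT (s : ℂ) := regularMat_constMat s (toC T)
  have hlim : Tendsto (fun s : ℂ => s ^ (-1 : ℤ) • matVal s (S.transfer⁻¹ * constMat (toC T)))
      (Bornology.cobounded ℂ) (𝓝 (toC N * (toC N)ᴴ)) := by
    rw [← toC_conjTranspose, ← toC_mul, ← hN, toC_mul]
    have h1 : Continuous fun Z : Matrix (Fin m) (Fin m) ℂ => Z * toC T :=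
      continuous_id.matrix_mul continuous_const
    refine ((h1.tendsto _).comp hM).congr' ?_
    filter_upwards [Bornology.le_cofinite ℂ (eventually_regularMat S.transfer⁻¹)] with s hs
    rw [hs.matVal_mul (hcT s), matVal_constMat, Function.comp_apply, Matrix.smul_mul]
  obtain ⟨b, hb⟩ := exists_forall_gt_posDef hε (fun s hs => (hreg s hs).mul (hcT s)) hlim
  obtain ⟨k, hk, hku⟩ := exists_gt_isUnit_one_add_smul (T⁻¹ * S.D) b
  set K : Matrix (Fin m) (Fin m) 𝕜 := (((-k : ℝ)) : 𝕜) • T⁻¹ with hK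
  have hKT : toC K * toC T = -((k : ℂ) • 1) := by
    rw [← toC_mul, hK, Matrix.smul_mul, Matrix.nonsing_inv_mul _ hTd, toC_ofReal_smul, toC_one]
    simp
  have hcK (s : ℂ) := regularMat_constMat s (toC K)
  set F := (S.transfer⁻¹ - constMat (toC K)) * constMat (toC T) with hF
  have hFr (s : ℂ) (hs : -ε ≤ s.re) : RegularMat s F := ((hreg s hs).sub (hcK s)).mul (hcT s)
  have hFv (s : ℂ) (hs : -ε ≤ s.re) : matVal s F = (matVal s S.transfer⁻¹ - toC K) * toC T := by
    rw [hF, ((hreg s hs).sub (hcK s)).matVal_mul (hcT s), (hreg s hs).matVal_sub (hcK s),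
      matVal_constMat, matVal_constMat]
  have hpos (s : ℂ) (hs : -ε ≤ s.re) : (matVal s F + (matVal s F)ᴴ).PosDef := by
    have h1 := hb k hk s hs
    rw [(hreg s hs).matVal_mul (hcT s), matVal_constMat] at h1
    rwa [hFv s hs, sub_mul, hKT, sub_neg_eq_add]
  have hKD : IsUnit (1 - K * S.D) := by
    rwa [hK, Matrix.smul_mul, RCLike.ofReal_neg, neg_smul, sub_neg_eq_add]
  refine ⟨K, T⁻¹, hKD, fun z hz => ?_, ε, hε, fun s hs _ => ?_⟩
  · by_contra! hz0
    refine S.not_isPairEigenvalue_closedLoop hS hG hKD (hpole z hz0) ?_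
      (fun h => (hc z (Or.inl h)).not_ge hz0) (fun h => (hc z (Or.inr h)).not_ge hz0) hz
    have h1 := isUnit_of_posDef_add_conjTranspose (hpos z (by linarith))
    rw [hFv z (by linarith), Matrix.isUnit_iff_isUnit_det, Matrix.det_mul] at h1
    exact (Matrix.isUnit_iff_isUnit_det _).2 (isUnit_of_mul_isUnit_left h1)
  · have h1 := hpos s hs
    rw [valueAt_eq_matVal, S.closedLoopTransfer_eq_inv hG hT,
      (hFr s hs).matVal_inv (isUnit_of_posDef_add_conjTranspose h1)]
    exact posDef_inv_add_conjTranspose h1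

/-- If `H = L (I - G K)⁻¹ G` is invertible then so is `G`, and `G⁻¹ = H⁻¹ L + K`. -/
theorem inv_transfer_eq {K L : Matrix (Fin m) (Fin m) 𝕜}
    (h : IsUnit (S.closedLoopTransfer K L)) :
    IsUnit S.transfer ∧
      S.transfer⁻¹ = (S.closedLoopTransfer K L)⁻¹ * constMat (toC L) + constMat (toC K) := by
  have h1 := h
  rw [closedLoopTransfer, Matrix.isUnit_iff_isUnit_det, Matrix.det_mul, Matrix.det_mul,
    IsUnit.mul_iff, IsUnit.mul_iff] at h1
  obtain ⟨⟨hL, hI⟩, hG⟩ := h1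
  rw [Matrix.isUnit_nonsing_inv_det_iff] at hI
  refine ⟨(Matrix.isUnit_iff_isUnit_det _).2 hG, ?_⟩
  rw [closedLoopTransfer, Matrix.mul_inv_rev, Matrix.mul_inv_rev,
    Matrix.nonsing_inv_nonsing_inv _ hI, mul_assoc, mul_assoc, Matrix.nonsing_inv_mul _ hL, mul_one,
    mul_sub, mul_one, ← mul_assoc, Matrix.nonsing_inv_mul _ hG, one_mul, sub_add_cancel]

end DescriptorSystem

theorem hasScaledLimitAtInfinity_of_linearGrowth {m : ℕ} {H : TransferMatrix m}
    (h : ∀ i j, H i j ∈ linearGrowth) : HasScaledLimitAtInfinity H 1 := by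
  choose c hc using fun i j => exists_tendsto_of_intDegree_le (h i j)
  exact ⟨Matrix.of c, tendsto_pi_nhds.2 fun i => tendsto_pi_nhds.2 fun j => hc i j⟩

/-- A pole at infinity excludes all nonpositive orders. -/
theorem hasOrderAtInfinity_one {m : ℕ} {H : TransferMatrix m} (hp : IsPoleAtInfinity H)
    (h : HasScaledLimitAtInfinity H 1) : HasOrderAtInfinity H 1 := by
  refine ⟨h, fun k hk => ?_⟩
  obtain ⟨M, hM⟩ := hk
  by_contra! hk1
  obtain ⟨c, hc⟩ := tendsto_zpow_cobounded (k := k) (by lia)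
  refine hp ⟨c • M, (hc.smul hM).congr' ?_⟩
  filter_upwards [Bornology.eventually_ne_cobounded (0 : ℂ)] with s hs
  rw [smul_smul, ← zpow_add₀ hs, add_neg_cancel, zpow_zero, one_smul]

end SPRification

end

theorem theorem2 {𝕜 : Type*} [RCLike 𝕜] {n m : ℕ}
    (S : SPRification.DescriptorSystem 𝕜 n m) (hS : S.IsRegular) :
    S.CanBeMadeStableSPR ↔
      IsUnit S.transfer ∧
      (∀ z : ℂ, SPRification.IsPole S.transfer⁻¹ z → z.re < 0) ∧
      (SPRification.IsPoleAtInfinity S.transfer⁻¹ →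
        SPRification.HasOrderAtInfinity S.transfer⁻¹ 1) ∧
      (∀ z : ℂ, S.IsUncontrollableEigenvalue z ∨ S.IsUnobservableEigenvalue z → z.re < 0) := by
  constructor
  · rintro ⟨K, L, -, hstab, hspr⟩
    obtain ⟨hHu, hHreg, hHgrow⟩ := hspr.inverse
    obtain ⟨hG, hGi⟩ := S.inv_transfer_eq hHu
    refine ⟨hG, fun z hz => ?_, fun hp => ?_, fun z hz => S.re_neg_of_isStablePair hstab hz⟩
    · by_contra! hz0
      refine SPRification.not_isPole_iff.2 ?_ hz
      rw [hGi]
      exact ((hHreg z hz0).mul (SPRification.regularMat_constMat _ _)).add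
        (SPRification.regularMat_constMat _ _)
    · refine SPRification.hasOrderAtInfinity_one hp
        (SPRification.hasScaledLimitAtInfinity_of_linearGrowth fun i j => ?_)
      rw [hGi]
      rw [Matrix.add_apply, Matrix.mul_apply]
      refine add_mem (sum_mem fun k _ => ?_) ?_
      · have := SPRification.linearGrowth.smul_mem (SPRification.toC L k j) (hHgrow i k)
        rwa [RatFunc.smul_eq_C_mul, mul_comm] at this
      · rw [SPRification.mem_linearGrowth]
        exact (RatFunc.intDegree_C _).trans_le zero_le_one
  · rintro ⟨hG, ha, hb, hc⟩
    refine S.canBeMadeStableSPR hS hG (fun z hz => ?_) ?_ hc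
    · exact SPRification.not_isPole_iff.1 fun h => (ha z h).not_ge hz
    · by_cases hp : SPRification.IsPoleAtInfinity S.transfer⁻¹
      · exact (hb hp).1
      · exact .of_not_isPoleAtInfinity hp
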